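/- Let $k$ be an algebraically closed field and let $X$ be a non-singular algebraic variety over $k$ (an integral separated scheme of finite type over $k$, with the Zariski topology, whose local rings at closed points are regular). Points are closed points, and subvarieties carry their reduced structure. An intersection $A\cap B$ of closed non-singular subvarieties is \emph{clean} if it is non-singular and $T_y(A\cap B)=T_yA\cap T_yB$ for every $y\in A\cap B$. Finitely many non-singular subvarieties $A_1,\dots,A_r$ intersect \emph{transversally} if at every $y\in A_1\cap\dots\cap A_r$ the annihilators $(T_yA_i)^\perp\subseteq (T_yX)^*$ form a direct sum. An \emph{arrangement of subvarieties} of $X$ is a finite set $\Lambda$ of (non-empty) non-singular closed connected subvarieties properly contained in $X$ such that for all $A,B\in\Lambda$ the intersection $A\cap B$ is either empty, or is a disjoint union of elements of $\Lambda$ and is clean; it is \emph{simple} if moreover each non-empty $A\cap B$ belongs to $\Lambda$. For an open $U\subseteq X$ and a set $\Sigma$ of subvarieties put $\Sigma|_U=\{A\cap U : A\in\Sigma,\ A\cap U\neq\emptyset\}$. If $\Lambda$ is simple, $\mathcal G\subseteq\Lambda$ is a \emph{building set} for $\Lambda$ if for every $L\in\Lambda\setminus\mathcal G$ the minimal elements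 (with respect to inclusion) of $\{G\in\mathcal G : L\subseteq G\}$, called the $\mathcal G$-factors of $L$, intersect transversally and have intersection $L$; a subset $\mathcal S\subseteq\mathcal G$ is then \emph{$\mathcal G$-nested} if every antichain (set of pairwise non-comparable elements with respect to inclusion) in $\mathcal S$ with at least two elements is the set of $\mathcal G$-factors of some element of $\Lambda\setminus\mathcal G$. For a general arrangement $\Lambda$, $\mathcal G\subseteq\Lambda$ is a \emph{building set} for $\Lambda$ if $X$ has an open cover $\mathcal U$ such that for every $U\in\mathcal U$ the restriction $\Lambda|_U$ is a simple arrangement of subvarieties of $U$ and $\mathcal G|_U$ is a building set for it. A subset $\mathcal S\subseteq\mathcal G$ is \emph{$\mathcal G$-nested} if there are such an open cover $\mathcal U$ and a $W\in\mathcal U$ such that $A\cap W\neq\emptyset$ for all $A\in\mathcal S$ and $\mathcal S|_W$ is $\mathcal G|_W$-nested. The building set $\mathcal G$ is \emph{well-connected} if, for every $\mathcal H\subseteq\mathcal G$ such that $\bigcap\mathcal H$ has two or more connected components, each of these components belongs to $\mathcal G$. \textbf{Proposition.} Let $\Lambda$ be an arrangement of subvarieties of $X$ and let $\mathcal G$ be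 a well-connected building set for $\Lambda$. A subset $\mathcal S\subseteq\mathcal G$ is $\mathcal G$-nested if and only if, for every antichain $\mathcal H\subseteq\mathcal S$ with at least two elements, the intersection $\bigcap\mathcal H$ is non-empty, connected, transversal, and does not belong to $\mathcal G$. -/

import Mathlib

open AlgebraicGeometry CategoryTheory TopologicalSpace

universe u

noncomputable section

namespace WonderfulArr

variable {X : Scheme.{u}}

/-! Varieties are schemes, subvarieties of `X` are (relatively) closed subsets of the underlying
space with their reduced structure, and the points of a variety are the closed points of the
scheme. All notions below are given for an open subset `U` of `X`, regarded as a variety of its own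
(the closed points of `U` are the closed points of `X` that lie in `U`); `U = ⊤` is `X` itself. -/

/-- The ideal `I_{Z,y}` of the reduced subvariety `Z` in the local ring `𝒪_{X,y}`: the germs at `y`
that vanish on `Z`, i.e. at all points of `Z` that specialize to `y` (these are the points of `Z`
in `Spec 𝒪_{X,y}`). Hence `𝒪_{Z,y} = 𝒪_{X,y} / I_{Z,y}`. -/
def stalkIdeal (Z : Set X) (y : X) : Ideal (X.presheaf.stalk y) :=
  PrimeSpectrum.vanishingIdeal (X.fromSpecStalk y ⁻¹' Z)

/-- `Z` is non-singular: the local ring `𝒪_{Z,y}` is regular for every closed point `y` of `Z`. -/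
def IsNonsingular (Z : Set X) : Prop :=
  ∀ y ∈ Z, IsClosed ({y} : Set X) → IsRegularLocalRing (X.presheaf.stalk y ⧸ stalkIdeal Z y)

/-- The residue field of `X` at `y`. -/
abbrev resField (y : X) : Type u := IsLocalRing.ResidueField (X.presheaf.stalk y)

/-- The Zariski cotangent space `𝔪_y / 𝔪_y²` of `X` at `y`. -/
abbrev cotangentSp (y : X) : Type u := IsLocalRing.CotangentSpace (X.presheaf.stalk y)

/-- The Zariski tangent space of `X` at `y`. -/
abbrev tangentSp (y : X) : Type u := Module.Dual (resField y) (cotangentSp y)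

/-- The conormal space of `Z` at `y`: the image of `I_{Z,y}` in `𝔪_y / 𝔪_y²`. -/
def conormalSpace (Z : Set X) (y : X) : Submodule (resField y) (cotangentSp y) :=
  Submodule.span _ ((IsLocalRing.maximalIdeal (X.presheaf.stalk y)).toCotangent ''
    {a | (a : X.presheaf.stalk y) ∈ stalkIdeal Z y})

/-- The tangent space `T_y Z`, as a subspace of `T_y X`: the tangent vectors that vanish on the
functions vanishing on `Z`. -/
def tangentSpace (Z : Set X) (y : X) : Submodule (resField y) (tangentSp y) :=
  (conormalSpace Z y).dualAnnihilator

/-- The intersection of `A` and `B` is clean: it is non-singular and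
`T_y (A ∩ B) = T_y A ∩ T_y B` at each of its points. -/
def IsCleanInter (A B : Set X) : Prop :=
  IsNonsingular (A ∩ B) ∧
    ∀ y ∈ A ∩ B, IsClosed ({y} : Set X) →
      tangentSpace (A ∩ B) y = tangentSpace A y ⊓ tangentSpace B y

/-- The members of `F` intersect transversally: at each point `y` of their intersection the
conormal spaces `(T_y A)^⊥`, `A ∈ F`, form a direct sum in the cotangent space (equivalently,
for finite `F`, the codimension of `⋂ T_y A` in `T_y X` is the sum of the codimensions
of the `T_y A`). -/
def IsTransversal (F : Set (Set X)) : Prop :=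
  ∀ y ∈ ⋂₀ F, IsClosed ({y} : Set X) → iSupIndep fun A : F => conormalSpace (A : Set X) y

/-- `L` is a non-singular closed connected subvariety of `U`, properly contained in `U`. -/
structure IsArrMember (U : X.Opens) (L : Set X) : Prop where
  closed_in : ∃ C : Set X, IsClosed C ∧ L = C ∩ U
  proper : L ≠ U
  connected : _root_.IsConnected L
  nonsingular : IsNonsingular L

/-- `Λ` is a simple arrangement of subvarieties of `U`. -/
structure IsSimpleArrangement (U : X.Opens) (Λ : Set (Set X)) : Prop where
  finite : Λ.Finite
  mem : ∀ L ∈ Λ, IsArrMember U L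
  inter : ∀ A ∈ Λ, ∀ B ∈ Λ, A ∩ B ∈ Λ ∨ A ∩ B = ∅
  clean : ∀ A ∈ Λ, ∀ B ∈ Λ, (A ∩ B).Nonempty → IsCleanInter A B

/-- `Λ` is an arrangement of subvarieties of `U`. -/
structure IsArrangement (U : X.Opens) (Λ : Set (Set X)) : Prop where
  finite : Λ.Finite
  mem : ∀ L ∈ Λ, IsArrMember U L
  inter : ∀ A ∈ Λ, ∀ B ∈ Λ,
    (∃ T ⊆ Λ, T.PairwiseDisjoint id ∧ A ∩ B = ⋃₀ T) ∨ A ∩ B = ∅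
  clean : ∀ A ∈ Λ, ∀ B ∈ Λ, (A ∩ B).Nonempty → IsCleanInter A B

/-- The restriction `Λ|_U` of a set of subvarieties to an open set. -/
def restr (Λ : Set (Set X)) (U : X.Opens) : Set (Set X) :=
  {M | ∃ L ∈ Λ, (L ∩ U).Nonempty ∧ M = L ∩ U}

/-- The minimal elements of `{G ∈ 𝒢 | L ⊆ G}`; for `L ∉ 𝒢` these are the `𝒢`-factors of `L`. -/
def factors (𝒢 : Set (Set X)) (L : Set X) : Set (Set X) :=
  {A | Minimal (fun G => G ∈ 𝒢 ∧ L ⊆ G) A}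

/-- `𝒢` is a building set for the simple arrangement `Λ`. -/
def IsSimpleBuilding (𝒢 Λ : Set (Set X)) : Prop :=
  𝒢 ⊆ Λ ∧ ∀ L ∈ Λ \ 𝒢, IsTransversal (factors 𝒢 L) ∧ ⋂₀ factors 𝒢 L = L

/-- `S` is `𝒢`-nested, for a building set `𝒢` of the simple arrangement `Λ`. -/
def IsSimpleNested (𝒢 Λ S : Set (Set X)) : Prop :=
  S ⊆ 𝒢 ∧ ∀ H ⊆ S, IsAntichain (· ⊆ ·) H → H.Nontrivial → ∃ L ∈ Λ \ 𝒢, factors 𝒢 L = H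

/-- `𝒰` is an open cover of `X` such that, on every `U ∈ 𝒰`, the arrangement `Λ` restricts to a
simple arrangement and `𝒢` to a building set for it. -/
def IsBuildingCover (𝒢 Λ : Set (Set X)) (𝒰 : Set X.Opens) : Prop :=
  sSup 𝒰 = ⊤ ∧
    ∀ U ∈ 𝒰, IsSimpleArrangement U (restr Λ U) ∧ IsSimpleBuilding (restr 𝒢 U) (restr Λ U)

/-- `𝒢` is a building set for the arrangement `Λ` of subvarieties of `X`. -/
def IsBuilding (𝒢 Λ : Set (Set X)) : Prop :=
  𝒢 ⊆ Λ ∧ ∃ 𝒰 : Set X.Opens, IsBuildingCover 𝒢 Λ 𝒰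

/-- `S` is `𝒢`-nested, for a building set `𝒢` of the arrangement `Λ`. -/
def IsNested (𝒢 Λ S : Set (Set X)) : Prop :=
  S ⊆ 𝒢 ∧ ∃ 𝒰 : Set X.Opens, IsBuildingCover 𝒢 Λ 𝒰 ∧
    ∃ W ∈ 𝒰, (∀ A ∈ S, (A ∩ W).Nonempty) ∧ IsSimpleNested (restr 𝒢 W) (restr Λ W) (restr S W)

/-- The set of connected components of a subset `Z`. -/
def components (Z : Set X) : Set (Set X) :=
  {C | ∃ x ∈ Z, C = connectedComponentIn Z x}

/-- Whenever an intersection of members of `𝒢` has two or more connected components, these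
components belong to `𝒢`. -/
def IsWellConnected (𝒢 : Set (Set X)) : Prop :=
  ∀ H ⊆ 𝒢, (components (⋂₀ H)).Nontrivial → components (⋂₀ H) ⊆ 𝒢

end WonderfulArr

end

/-!
Regular local rings are domains, so a connected non-singular subvariety is irreducible, and it can
be recovered from its trace on any open set that it meets. By dimension, a proper quotient of a
regular local ring that is itself regular has a smaller cotangent space. Hence in a simple
arrangement the inclusions between members through a closed point `y` can be read off from their
conormal spaces at `y`.

Let `H` be a set of members of a simple building set no two or more of which intersect in an
element of the building set. The conormal space of `⋂₀ H` is spanned by those of the members of `H`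
and is the direct sum of those of the factors of `⋂₀ H`. Each member of `H` contains a factor, so by
the modular law the conormal space of a factor `A` is spanned by those of the members of `H` that
contain `A`. Hence `A` is their intersection, and therefore equal to one of them.

In the global situation the members of `S` have a common point as soon as its antichains do, which
provides the open set `W`. Conversely, a disconnected `⋂₀ H` would by well-connectedness have all
its components in the building set, although its trace on `W` is not in the restriction.
-/

namespace WonderfulArr

open IsLocalRing

section LocalRing

variable {R : Type*} [CommRing R] [IsLocalRing R]

/-- The conormal space of an ideal `I` of a local ring: the image of `I ∩ 𝔪` in `𝔪 / 𝔪²`. It makes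
sense of `conormalSpace` for the closed subschemes of an arbitrary local scheme. -/
noncomputable def conormal (I : Ideal R) : Submodule (ResidueField R) (CotangentSpace R) :=
  Submodule.span _ ((maximalIdeal R).toCotangent '' {a | (a : R) ∈ I})

lemma restrictScalars_conormal (I : Ideal R) :
    (conormal I).restrictScalars R =
      (Submodule.comap (maximalIdeal R).subtype I).map (maximalIdeal R).toCotangent := by
  rw [conormal, Submodule.restrictScalars_span R _ residue_surjective]
  exact Submodule.span_eq (Submodule.map _ (Submodule.comap (maximalIdeal R).subtype I))

lemma finrank_cotangentSpace_quotient (I : Ideal R) [IsLocalRing (R ⧸ I)] :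
    Module.finrank (ResidueField (R ⧸ I)) (CotangentSpace (R ⧸ I)) =
      Module.finrank (ResidueField R) (CotangentSpace R ⧸ conormal I) := by
  have hsurj : Function.Surjective (algebraMap R (R ⧸ I)) := Ideal.Quotient.mk_surjective
  have : IsLocalHom (algebraMap R (R ⧸ I)) := .of_surjective _ hsurj
  have hker : RingHom.ker (algebraMap R (R ⧸ I)) = I := Ideal.mk_ker
  have hI : I ≤ maximalIdeal R := le_maximalIdeal (Ideal.Quotient.nontrivial_iff.1 inferInstance)
  have hcomap : (maximalIdeal (R ⧸ I)).comap (algebraMap R (R ⧸ I)) =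
      RingHom.ker (algebraMap R (R ⧸ I)) ⊔ maximalIdeal R := by
    rw [maximalIdeal_comap, hker, sup_eq_right.2 hI]
  let φ := Ideal.mapCotangent _ _ (Algebra.ofId R (R ⧸ I)) (le_of_le_of_eq le_sup_right hcomap.symm)
  have hφ : φ.ker = (conormal I).restrictScalars R := by
    rw [restrictScalars_conormal, Ideal.mapCotangent_ker_of_surjective hsurj hcomap, hker,
      inf_eq_left.2 hI]
  let e : (CotangentSpace R ⧸ (conormal I).restrictScalars R) ≃ₗ[R] CotangentSpace (R ⧸ I) :=
    (Submodule.quotEquivOfEq _ _ hφ.symm).trans (φ.quotKerEquivOfSurjective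
      (Ideal.mapCotangent_surjective_of_comap_eq hsurj hcomap))
  have hres : Function.Bijective (ResidueField.map (algebraMap R (R ⧸ I))) := by
    refine ⟨RingHom.injective _, .of_comp (g := residue R) ?_⟩
    exact residue_surjective.comp hsurj
  refine (congrArg Cardinal.toNat (rank_eq_of_equiv_equiv
    (M := CotangentSpace R ⧸ conormal I) _ e.toAddEquiv hres ?_)).symm
  intro r v
  obtain ⟨r, rfl⟩ := residue_surjective r
  obtain ⟨v, rfl⟩ := Submodule.Quotient.mk_surjective _ v
  exact e.map_smul r (Submodule.Quotient.mk v)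

section Noetherian

variable [IsNoetherianRing R]

lemma eq_bot_of_le_maximalIdeal_smul {I : Ideal R} (h : I ≤ maximalIdeal R * I) : I = ⊥ :=
  Submodule.eq_bot_of_le_smul_of_le_jacobson_bot _ _ I.fg_of_isNoetherianRing h
    (jacobson_eq_maximalIdeal _ bot_ne_top).ge

lemma exists_mem_maximalIdeal_notMem_sq_notMem_minimalPrimes
    (hmin : maximalIdeal R ∉ minimalPrimes R) :
    ∃ x ∈ maximalIdeal R, x ∉ maximalIdeal R ^ 2 ∧ ∀ p ∈ minimalPrimes R, x ∉ p := by
  have hsq : ¬ maximalIdeal R ≤ maximalIdeal R ^ 2 := by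
    intro h
    have hbot : maximalIdeal R = ⊥ := eq_bot_of_le_maximalIdeal_smul (h.trans_eq (pow_two _))
    exact hmin ⟨⟨inferInstance, bot_le⟩, fun p _ _ => hbot ▸ bot_le⟩
  by_contra! h
  have hcover : (maximalIdeal R : Set R) ⊆
      ⋃ I ∈ insert (maximalIdeal R ^ 2) (minimalPrimes R), (I : Set R) := by
    intro x hx
    by_cases hx2 : x ∈ maximalIdeal R ^ 2
    · exact Set.mem_biUnion (Set.mem_insert _ _) hx2
    · obtain ⟨p, hp, hxp⟩ := h x hx hx2
      exact Set.mem_biUnion (Set.mem_insert_of_mem _ hp) hxp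
  obtain ⟨I, rfl | hI, hle⟩ := (Ideal.subset_union_prime_finite (f := id)
    ((minimalPrimes.finite_of_isNoetherianRing R).insert _) (maximalIdeal R ^ 2)
    (maximalIdeal R ^ 2) fun I hI hne _ => (hI.resolve_left hne).1.1).1 hcover
  · exact hsq hle
  · have : I.IsPrime := hI.1.1
    exact hmin ((maximalIdeal.isMaximal R).eq_of_le this.ne_top hle ▸ hI)

lemma isDomain_of_isPrime_span_singleton {x : R} (hx : x ∈ maximalIdeal R)
    (hmin : ∀ p ∈ minimalPrimes R, x ∉ p) (hprime : (Ideal.span {x}).IsPrime) : IsDomain R := by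
  obtain ⟨p, hp, hpx⟩ := Ideal.exists_minimalPrimes_le (J := Ideal.span {x}) bot_le
  have : p.IsPrime := hp.1.1
  -- Since `p ≤ (x)` and `x ∉ p`, primality gives `p = x p`, and Nakayama's lemma applies.
  have hp0 : p = ⊥ := by
    refine eq_bot_of_le_maximalIdeal_smul fun a ha => ?_
    obtain ⟨b, rfl⟩ := Ideal.mem_span_singleton'.1 (hpx ha)
    rw [mul_comm b x]
    exact Ideal.mul_mem_mul hx ((this.mem_or_mem ha).resolve_right (hmin p hp))
  exact @IsDomain.of_bot_isPrime R _ (hp0 ▸ this)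

lemma finrank_cotangentSpace_quotient_span_singleton_lt {x : R} (hx : x ∈ maximalIdeal R)
    (hx2 : x ∉ maximalIdeal R ^ 2) [IsLocalRing (R ⧸ Ideal.span {x})] :
    Module.finrank (ResidueField (R ⧸ Ideal.span {x})) (CotangentSpace (R ⧸ Ideal.span {x})) <
      Module.finrank (ResidueField R) (CotangentSpace R) := by
  have hne : conormal (Ideal.span {x}) ≠ ⊥ := by
    have hmem : (maximalIdeal R).toCotangent ⟨x, hx⟩ ∈ conormal (Ideal.span {x}) :=
      Submodule.subset_span ⟨_, Ideal.mem_span_singleton_self x, rfl⟩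
    intro h
    rw [h, Submodule.mem_bot, Ideal.toCotangent_eq_zero] at hmem
    exact hx2 hmem
  have hpos := Submodule.one_le_finrank_iff.2 hne
  have hadd := Submodule.finrank_quotient_add_finrank (conormal (Ideal.span {x}))
  rw [finrank_cotangentSpace_quotient]
  omega

end Noetherian

end LocalRing

lemma ringKrullDim_eq_finrank_cotangentSpace (R : Type*) [CommRing R] [IsRegularLocalRing R] :
    ringKrullDim R = Module.finrank (ResidueField R) (CotangentSpace R) :=
  ((IsRegularLocalRing.iff_finrank_cotangentSpace R).1 inferInstance).symm

lemma isRegularLocalRing_quotient_span_singleton {R : Type*} [CommRing R] [IsRegularLocalRing R]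
    {x : R} (hx : x ∈ maximalIdeal R) (hx2 : x ∉ maximalIdeal R ^ 2) :
    IsRegularLocalRing (R ⧸ Ideal.span {x}) := by
  have : Nontrivial (R ⧸ Ideal.span {x}) := Ideal.Quotient.nontrivial_iff.2 fun h =>
    (mem_maximalIdeal x).1 hx (Ideal.span_singleton_eq_top.1 h)
  have : IsLocalRing (R ⧸ Ideal.span {x}) := .of_surjective' _ Ideal.Quotient.mk_surjective
  refine .of_spanFinrank_maximalIdeal_le _ ?_
  rw [spanFinrank_maximalIdeal_eq_finrank_cotangentSpace]
  have hlt := finrank_cotangentSpace_quotient_span_singleton_lt hx hx2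
  have hdim : ((maximalIdeal R).height : WithBot ℕ∞) ≤ ringKrullDim (R ⧸ Ideal.span {x}) + 1 :=
    Ideal.height_le_ringKrullDim_quotient_add_one hx
  rw [maximalIdeal_height_eq_ringKrullDim, ringKrullDim_eq_finrank_cotangentSpace] at hdim
  refine ENat.WithBot.add_le_add_one_right_iff.1 (le_trans ?_ hdim)
  exact_mod_cast hlt

theorem isDomain_of_isRegularLocalRing (R : Type*) [CommRing R] [IsRegularLocalRing R] :
    IsDomain R := by
  induction hn : Module.finrank (ResidueField R) (CotangentSpace R) using Nat.strong_induction_on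
    generalizing R with
  | h n ih =>
  subst hn
  by_cases hmin : maximalIdeal R ∈ minimalPrimes R
  · have hdim := maximalIdeal_height_eq_ringKrullDim (R := R)
    rw [Ideal.height_eq_zero_iff.2 hmin, ringKrullDim_eq_finrank_cotangentSpace] at hdim
    exact (finrank_cotangentSpace_eq_zero_iff.1 (by exact_mod_cast hdim.symm)).isDomain
  · obtain ⟨x, hx, hx2, hxmin⟩ := exists_mem_maximalIdeal_notMem_sq_notMem_minimalPrimes hmin
    have := isRegularLocalRing_quotient_span_singleton hx hx2
    have := ih _ (finrank_cotangentSpace_quotient_span_singleton_lt hx hx2) (R ⧸ Ideal.span {x}) rfl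
    exact isDomain_of_isPrime_span_singleton hx hxmin ((Ideal.Quotient.isDomain_iff_prime _).1 this)

lemma ideal_eq_bot_of_ringKrullDim_le_quotient {R : Type*} [CommRing R] [IsDomain R]
    [FiniteRingKrullDim R] {I : Ideal R} (h : ringKrullDim R ≤ ringKrullDim (R ⧸ I)) : I = ⊥ := by
  by_contra hne
  obtain ⟨r, hrI, hr0⟩ := Submodule.exists_mem_ne_zero_of_ne_bot hne
  have hle : ringKrullDim (R ⧸ I) ≤ ringKrullDim (R ⧸ Ideal.span {r}) :=
    ringKrullDim_le_of_surjective
      (Ideal.Quotient.factor ((Ideal.span_singleton_le_iff_mem _).2 hrI))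
      (Ideal.Quotient.factor_surjective _)
  have hlt : ringKrullDim R + 1 ≤ ringKrullDim R :=
    (add_le_add_left (h.trans hle) 1).trans
      (ringKrullDim_quotient_succ_le_of_nonZeroDivisor (mem_nonZeroDivisors_of_ne_zero hr0))
  rw [ringKrullDim, Order.krullDim_eq_length_of_finiteDimensionalOrder] at hlt
  norm_cast at hlt
  omega

theorem eq_of_le_of_conormal_le {R : Type*} [CommRing R] [IsLocalRing R] {I J : Ideal R}
    [IsRegularLocalRing (R ⧸ I)] [IsRegularLocalRing (R ⧸ J)] (hJI : J ≤ I)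
    (h : conormal I ≤ conormal J) : I = J := by
  have hconormal : conormal I = conormal J :=
    h.antisymm (Submodule.span_mono (Set.image_mono fun _ ha => hJI ha))
  have := isDomain_of_isRegularLocalRing (R ⧸ J)
  let e := DoubleQuot.quotQuotEquivQuotOfLE hJI
  have hdim : ringKrullDim (R ⧸ J) ≤ ringKrullDim ((R ⧸ J) ⧸ I.map (Ideal.Quotient.mk J)) := by
    rw [ringKrullDim_eq_of_ringEquiv e, ringKrullDim_eq_finrank_cotangentSpace,
      ringKrullDim_eq_finrank_cotangentSpace, finrank_cotangentSpace_quotient,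
      finrank_cotangentSpace_quotient, hconormal]
  have hmap := ideal_eq_bot_of_ringKrullDim_le_quotient hdim
  rw [Ideal.map_eq_bot_iff_le_ker, Ideal.mk_ker] at hmap
  exact hmap.antisymm hJI

section Topology

variable {α : Type*} [TopologicalSpace α]

lemma isPreirreducible_of_subset_closure {S T : Set α} (hS : IsPreirreducible S) (hST : S ⊆ T)
    (hT : T ⊆ closure S) : IsPreirreducible T :=
  isPreirreducible_iff_closure.1 <| by
    rwa [(closure_minimal hT isClosed_closure).antisymm (closure_mono hST),
      isPreirreducible_iff_closure]

lemma isPreirreducible_of_isPreconnected_of_locally {Z : Set α} (hZ : IsPreconnected Z)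
    (h : ∀ z ∈ Z, ∃ V, IsOpen V ∧ z ∈ V ∧ IsPreirreducible (Z ∩ V)) : IsPreirreducible Z := by
  rintro U₁ U₂ hU₁ hU₂ ⟨z₁, hz₁⟩ ⟨z₂, hz₂⟩
  let C := closure (Z ∩ U₁)
  have hopen : Z ∩ C ⊆ interior (Zᶜ ∪ C) := by
    rintro z ⟨hz, hzC⟩
    obtain ⟨V, hV, hzV, hirr⟩ := h z hz
    obtain ⟨x, hxV, hxZ, hxU₁⟩ := mem_closure_iff.1 hzC V hV hzV
    have hdense : Z ∩ V ⊆ closure ((Z ∩ V) ∩ U₁) :=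
      subset_closure_inter_of_isPreirreducible_of_isOpen hirr hU₁ ⟨x, ⟨hxZ, hxV⟩, hxU₁⟩
    refine interior_maximal (fun v hv => or_iff_not_imp_left.2 fun hvZ => ?_) hV hzV
    exact closure_mono (Set.inter_subset_inter_left _ Set.inter_subset_left)
      (hdense ⟨not_not.1 hvZ, hv⟩)
  have hcover : Z ⊆ interior (Zᶜ ∪ C) ∪ Cᶜ := fun z hz =>
    or_iff_not_imp_right.2 fun hzC => hopen ⟨hz, not_not.1 hzC⟩
  have hz₂C : z₂ ∈ C := by
    by_contra hz₂C
    obtain ⟨z, hz, hzint, hzC⟩ := hZ _ _ isOpen_interior isClosed_closure.isOpen_compl hcover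
      ⟨z₁, hz₁.1, hopen ⟨hz₁.1, subset_closure hz₁⟩⟩ ⟨z₂, hz₂.1, hz₂C⟩
    exact (interior_subset hzint).elim (absurd hz) hzC
  obtain ⟨z, hzU₂, hz, hzU₁⟩ := mem_closure_iff.1 hz₂C U₂ hU₂ hz₂.2
  exact ⟨z, hz, hzU₁, hzU₂⟩

lemma exists_finite_isIrreducible_cover {Z U : Set α} (hZ : IsClosed Z) [NoetherianSpace U] :
    ∃ F : Set (Set α), F.Finite ∧ (∀ T ∈ F, IsClosed T ∧ IsIrreducible T ∧ T ⊆ Z) ∧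
      Z ∩ U ⊆ ⋃₀ F := by
  obtain ⟨F, hfin, -, hirr, hF⟩ := NoetherianSpace.exists_finite_set_isClosed_irreducible
    (hZ.preimage (continuous_subtype_val (p := (· ∈ U))))
  refine ⟨(fun T => closure (Subtype.val '' T)) '' F, hfin.image _, ?_, ?_⟩
  · rintro _ ⟨T, hT, rfl⟩
    refine ⟨isClosed_closure, ((hirr T hT).image _ continuous_subtype_val.continuousOn).closure,
      closure_minimal (Set.image_subset_iff.2 ?_) hZ⟩
    exact hF ▸ Set.subset_sUnion_of_mem hT
  · rintro z ⟨hz, hzU⟩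
    have hz' : (⟨z, hzU⟩ : U) ∈ ⋃₀ F := hF ▸ hz
    obtain ⟨T, hT, hzT⟩ := hz'
    exact ⟨_, ⟨T, hT, rfl⟩, subset_closure ⟨_, hzT, rfl⟩⟩

lemma exists_isOpen_isPreirreducible_inter [QuasiSober α] {Z U : Set α} (hZ : IsLocallyClosed Z)
    (hU : IsOpen U) [NoetherianSpace U] {y : α} (hyZ : y ∈ Z) (hyU : y ∈ U)
    (h : IsPreirreducible (Z ∩ {z | z ⤳ y})) :
    ∃ V, IsOpen V ∧ y ∈ V ∧ IsPreirreducible (Z ∩ V) := by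
  obtain ⟨O, C, hO, hC, rfl⟩ := hZ
  obtain ⟨F, hfin, hF, hcover⟩ := exists_finite_isIrreducible_cover (U := U) hC
  -- Once the components missing `y` are removed, all generic points specialize to `y`.
  let V := U ∩ (⋃ T ∈ {T ∈ F | y ∉ T}, T)ᶜ
  have hV : IsOpen V := hU.inter ((hfin.subset (Set.sep_subset _ _)).isClosed_biUnion
    fun T hT => (hF T hT.1).1).isOpen_compl
  have hyV : y ∈ V := ⟨hyU, by simp⟩
  refine ⟨V, hV, hyV, isPreirreducible_of_subset_closure h
    (fun z hz => ⟨hz.1, hz.2.mem_open hV hyV⟩) ?_⟩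
  rintro z ⟨⟨-, hzC⟩, hzU, hzV⟩
  obtain ⟨T, hT, hzT⟩ := hcover ⟨hzC, hzU⟩
  have hyT : y ∈ T := by
    by_contra hyT
    exact hzV (Set.mem_biUnion ⟨hT, hyT⟩ hzT)
  obtain ⟨hTc, hTi, hTC⟩ := hF T hT
  obtain ⟨η, hη⟩ := QuasiSober.sober hTi hTc
  have hηy : η ⤳ y := hη.specializes hyT
  have hη_mem : η ∈ O ∩ C ∩ {z | z ⤳ y} := ⟨⟨hηy.mem_open hO hyZ.1, hTC hη.mem⟩, hηy⟩
  exact closure_mono (Set.singleton_subset_iff.2 hη_mem) (hη.specializes hzT).mem_closure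

lemma subset_of_inter_subset {A B U : Set α} (hA : IsPreirreducible A) (hB : IsClosed B)
    (hU : IsOpen U) (hAU : (A ∩ U).Nonempty) (h : A ∩ U ⊆ B) : A ⊆ B :=
  (subset_closure_inter_of_isPreirreducible_of_isOpen hA hU hAU).trans (closure_minimal h hB)

end Topology

section Conormal

variable {X : Scheme.{u}}

lemma fromSpecStalk_specializes (y : X) (w : Spec (X.presheaf.stalk y)) :
    X.fromSpecStalk y w ⤳ y := by
  have hw : X.fromSpecStalk y w ∈ Set.range (X.fromSpecStalk y) := ⟨w, rfl⟩
  rwa [Scheme.range_fromSpecStalk] at hw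

lemma exists_fromSpecStalk_eq {y z : X} (h : z ⤳ y) : ∃ w, X.fromSpecStalk y w = z := by
  rwa [← Set.mem_range, Scheme.range_fromSpecStalk]

lemma conormalSpace_inter_open (Z : Set X) (U : X.Opens) {y : X} (hy : y ∈ U) :
    conormalSpace (Z ∩ U) y = conormalSpace Z y := by
  have hpre : X.fromSpecStalk y ⁻¹' (Z ∩ U) = X.fromSpecStalk y ⁻¹' Z :=
    Set.ext fun w => and_iff_left ((fromSpecStalk_specializes y w).mem_open U.2 hy)
  have hideal : stalkIdeal (Z ∩ U) y = stalkIdeal Z y :=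
    congrArg PrimeSpectrum.vanishingIdeal hpre
  rw [conormalSpace, conormalSpace, hideal]

lemma stalkIdeal_anti {A B : Set X} (h : A ⊆ B) (y : X) : stalkIdeal B y ≤ stalkIdeal A y :=
  PrimeSpectrum.vanishingIdeal_anti_mono (Set.preimage_mono h)

lemma conormalSpace_anti {A B : Set X} (h : A ⊆ B) (y : X) :
    conormalSpace B y ≤ conormalSpace A y :=
  Submodule.span_mono (Set.image_mono fun _ ha => stalkIdeal_anti h y ha)

lemma mem_closure_of_stalkIdeal_le {A B : Set X} {y z : X}
    (h : stalkIdeal A y ≤ stalkIdeal B y) (hzy : z ⤳ y) (hz : z ∈ B) : z ∈ closure A := by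
  obtain ⟨w, rfl⟩ := exists_fromSpecStalk_eq hzy
  have hw : w ∈ PrimeSpectrum.zeroLocus (stalkIdeal A y : Set (X.presheaf.stalk y)) :=
    PrimeSpectrum.zeroLocus_anti_mono h (PrimeSpectrum.subset_zeroLocus_vanishingIdeal _ hz)
  rw [stalkIdeal, PrimeSpectrum.zeroLocus_vanishingIdeal_eq_closure] at hw
  exact (X.fromSpecStalk y).continuous.closure_preimage_subset _ hw

lemma IsNonsingular.isIrreducible [IsLocallyNoetherian X] [JacobsonSpace X] {Z : Set X}
    (hns : IsNonsingular Z) (hZ : IsLocallyClosed Z) (hc : _root_.IsConnected Z) :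
    IsIrreducible Z := by
  refine ⟨hc.nonempty, isPreirreducible_of_isPreconnected_of_locally hc.isPreconnected ?_⟩
  intro z hz
  obtain ⟨y, ⟨hyz, hyZ⟩, hy⟩ := nonempty_inter_closedPoints (Z := closure {z} ∩ Z)
    ⟨z, subset_closure rfl, hz⟩ (isClosed_closure.isLocallyClosed.inter hZ)
  have := hns y hyZ hy
  have hprime : (stalkIdeal Z y).IsPrime :=
    (Ideal.Quotient.isDomain_iff_prime _).1 (isDomain_of_isRegularLocalRing _)
  have hirr : IsPreirreducible (Z ∩ {x | x ⤳ y}) := by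
    rw [← Scheme.range_fromSpecStalk, ← Set.image_preimage_eq_inter_range]
    exact (PrimeSpectrum.isIrreducible_iff_vanishingIdeal_isPrime.2 hprime).isPreirreducible.image _
      (X.fromSpecStalk y).continuous.continuousOn
  obtain ⟨U, hU, hyU, -⟩ := exists_isAffineOpen_mem_and_subset (x := y) (U := ⊤) trivial
  have : IsNoetherianRing Γ(X, U) := IsLocallyNoetherian.component_noetherian ⟨U, hU⟩
  have : NoetherianSpace (U : Set X) := noetherianSpace_of_isAffineOpen U hU
  obtain ⟨V, hV, hyV, hVirr⟩ :=
    exists_isOpen_isPreirreducible_inter hZ U.isOpen hyZ hyU hirr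
  exact ⟨V, hV, (specializes_iff_mem_closure.2 hyz).mem_open hV hyV, hVirr⟩

lemma subset_closure_of_conormalSpace_le {A B : Set X} {y : X} (hy : IsClosed ({y} : Set X))
    (hyA : y ∈ A) (hAB : A ⊆ B) (hA : IsNonsingular A) (hB : IsNonsingular B)
    (hBlc : IsLocallyClosed B) (hBirr : IsIrreducible B)
    (h : conormalSpace A y ≤ conormalSpace B y) : B ⊆ closure A := by
  have := hA y hyA hy
  have := hB y (hAB hyA) hy
  have hI : stalkIdeal A y = stalkIdeal B y := eq_of_le_of_conormal_le (stalkIdeal_anti hAB y) h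
  obtain ⟨O, C, hO, hC, rfl⟩ := hBlc
  obtain ⟨η, hη⟩ := QuasiSober.sober hBirr.closure isClosed_closure
  have hηy : η ⤳ y := hη.specializes (subset_closure (hAB hyA))
  have hηB : η ∈ O ∩ C :=
    ⟨hηy.mem_open hO (hAB hyA).1, closure_minimal Set.inter_subset_right hC hη.mem⟩
  have hηA : closure {η} ⊆ closure A := closure_minimal
    (Set.singleton_subset_iff.2 (mem_closure_of_stalkIdeal_le hI.le hηy hηB))
    isClosed_closure
  exact subset_closure.trans (hη.def.symm.subset.trans hηA)

end Conormal

section SimpleArrangement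

variable {X : Scheme.{u}} {U : X.Opens} {Λ 𝒢 : Set (Set X)}

lemma IsArrMember.isLocallyClosed {L : Set X} (h : IsArrMember U L) : IsLocallyClosed L := by
  obtain ⟨C, hC, rfl⟩ := h.closed_in
  exact hC.isLocallyClosed.inter U.isOpen.isLocallyClosed

lemma IsArrMember.isIrreducible [IsLocallyNoetherian X] [JacobsonSpace X] {L : Set X}
    (h : IsArrMember U L) : IsIrreducible L :=
  h.nonsingular.isIrreducible h.isLocallyClosed h.connected

lemma IsArrMember.subset_open {L : Set X} (h : IsArrMember U L) : L ⊆ U := by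
  obtain ⟨C, -, rfl⟩ := h.closed_in
  exact Set.inter_subset_right

lemma IsArrMember.closure_inter_subset {L : Set X} (h : IsArrMember U L) : closure L ∩ U ⊆ L := by
  obtain ⟨C, hC, rfl⟩ := h.closed_in
  exact Set.inter_subset_inter_left _ (closure_minimal Set.inter_subset_left hC)

lemma IsArrMember.eq_of_conormalSpace_le [IsLocallyNoetherian X] [JacobsonSpace X] {A B : Set X}
    (hA : IsArrMember U A) (hB : IsArrMember U B) (hAB : A ⊆ B) {y : X} (hyA : y ∈ A)
    (hy : IsClosed ({y} : Set X)) (h : conormalSpace A y ≤ conormalSpace B y) : A = B := by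
  have hBA := subset_closure_of_conormalSpace_le hy hyA hAB hA.nonsingular hB.nonsingular
    hB.isLocallyClosed hB.isIrreducible h
  exact hAB.antisymm fun x hx => hA.closure_inter_subset ⟨hBA hx, hB.subset_open hx⟩

lemma IsCleanInter.conormalSpace_eq {A B : Set X} (h : IsCleanInter A B) {y : X}
    (hyAB : y ∈ A ∩ B) (hy : IsClosed ({y} : Set X)) :
    conormalSpace (A ∩ B) y = conormalSpace A y ⊔ conormalSpace B y := by
  have hT := h.2 y hyAB hy
  rw [tangentSpace, tangentSpace, tangentSpace, ← Submodule.dualAnnihilator_sup_eq] at hT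
  exact Subspace.dualAnnihilator_inj.1 hT

lemma IsSimpleArrangement.sInter (hΛ : IsSimpleArrangement U Λ) {H : Set (Set X)} (hH : H ⊆ Λ)
    (hHne : H.Nonempty) (hne : (⋂₀ H).Nonempty) :
    ⋂₀ H ∈ Λ ∧ ∀ y ∈ ⋂₀ H, IsClosed ({y} : Set X) →
      conormalSpace (⋂₀ H) y = ⨆ A ∈ H, conormalSpace A y := by
  induction H, hΛ.finite.subset hH using Set.Finite.induction_on with
  | empty => simp at hHne
  | @insert A H _ _ ih =>
    rw [Set.insert_subset_iff] at hH
    obtain rfl | hHne := H.eq_empty_or_nonempty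
    · simpa using hH.1
    rw [Set.sInter_insert] at hne ⊢
    obtain ⟨hmem, hconormal⟩ := ih hH.2 hHne (hne.mono Set.inter_subset_right)
    refine ⟨(hΛ.inter _ hH.1 _ hmem).resolve_right hne.ne_empty, fun y hyH hy => ?_⟩
    rw [(hΛ.clean _ hH.1 _ hmem hne).conormalSpace_eq hyH hy, hconormal y hyH.2 hy, iSup_insert]

lemma IsSimpleArrangement.subset_iff_conormalSpace_le [IsLocallyNoetherian X] [JacobsonSpace X]
    (hΛ : IsSimpleArrangement U Λ) {A B : Set X} (hA : A ∈ Λ) (hB : B ∈ Λ) {y : X}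
    (hyAB : y ∈ A ∩ B) (hy : IsClosed ({y} : Set X)) :
    A ⊆ B ↔ conormalSpace B y ≤ conormalSpace A y := by
  refine ⟨fun h => conormalSpace_anti h y, fun h => ?_⟩
  have hmem : A ∩ B ∈ Λ := (hΛ.inter A hA B hB).resolve_right (Set.Nonempty.ne_empty ⟨y, hyAB⟩)
  have hle : conormalSpace (A ∩ B) y ≤ conormalSpace A y := by
    rw [(hΛ.clean A hA B hB ⟨y, hyAB⟩).conormalSpace_eq hyAB hy, sup_eq_left.2 h]
  exact Set.inter_eq_left.1 <| (hΛ.mem _ hmem).eq_of_conormalSpace_le (hΛ.mem A hA)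
    Set.inter_subset_left hyAB hy hle

lemma mem_of_mem_factors {L A : Set X} (hA : A ∈ factors 𝒢 L) : A ∈ 𝒢 :=
  hA.1.1

lemma subset_of_mem_factors {L A : Set X} (hA : A ∈ factors 𝒢 L) : L ⊆ A :=
  hA.1.2

lemma exists_mem_factors_subset (h𝒢 : 𝒢.Finite) {L G : Set X} (hG : G ∈ 𝒢) (hLG : L ⊆ G) :
    ∃ A ∈ factors 𝒢 L, A ⊆ G := by
  obtain ⟨A, hAG, hA⟩ := (h𝒢.subset (Set.sep_subset 𝒢 (L ⊆ ·))).exists_le_minimal ⟨hG, hLG⟩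
  exact ⟨A, hA, hAG⟩

lemma IsSimpleBuilding.conormalSpace_eq_iSup (hG : IsSimpleBuilding 𝒢 Λ)
    (hΛ : IsSimpleArrangement U Λ) {H : Set (Set X)} (hH : H ⊆ 𝒢) (hHne : H.Nonempty)
    (hHG : ⋂₀ H ∉ 𝒢) {y : X} (hyH : y ∈ ⋂₀ H) (hy : IsClosed ({y} : Set X)) {A : Set X}
    (hA : A ∈ factors 𝒢 (⋂₀ H)) :
    conormalSpace A y = ⨆ B ∈ {B ∈ H | A ⊆ B}, conormalSpace B y := by
  obtain ⟨hmem, hconormal⟩ := hΛ.sInter (hH.trans hG.1) hHne ⟨y, hyH⟩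
  have htrans := (hG.2 _ ⟨hmem, hHG⟩).1 y
    (fun B hB => subset_of_mem_factors hB hyH) hy
  let others := ⨆ (B : factors 𝒢 (⋂₀ H)) (_ : B ≠ ⟨A, hA⟩), conormalSpace (B : Set X) y
  have hle : ⨆ B ∈ {B ∈ H | A ⊆ B}, conormalSpace B y ≤ conormalSpace A y :=
    iSup₂_le fun B hB => conormalSpace_anti hB.2 y
  have hcover : conormalSpace A y ≤ (⨆ B ∈ {B ∈ H | A ⊆ B}, conormalSpace B y) ⊔ others := by
    refine (conormalSpace_anti (subset_of_mem_factors hA) y).trans ?_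
    rw [hconormal y hyH hy]
    refine iSup₂_le fun B hB => ?_
    by_cases hAB : A ⊆ B
    · exact le_sup_of_le_left (le_iSup₂_of_le B ⟨hB, hAB⟩ le_rfl)
    · obtain ⟨C, hC, hCB⟩ := exists_mem_factors_subset (hΛ.finite.subset hG.1) (hH hB)
        (Set.sInter_subset_of_mem hB)
      have hCA : (⟨C, hC⟩ : factors 𝒢 (⋂₀ H)) ≠ ⟨A, hA⟩ := fun h =>
        hAB ((congrArg Subtype.val h).symm.subset.trans hCB)
      exact le_sup_of_le_right ((conormalSpace_anti hCB y).trans (le_iSup₂_of_le _ hCA le_rfl))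
  have hdisj : conormalSpace A y ⊓ others = ⊥ := (htrans ⟨A, hA⟩).eq_bot
  exact (eq_of_le_of_inf_le_of_le_sup hle (hdisj.trans_le bot_le) hcover).symm

lemma IsSimpleBuilding.nonempty_and_sInter_eq_of_mem_factors [IsLocallyNoetherian X]
    [JacobsonSpace X] (hG : IsSimpleBuilding 𝒢 Λ) (hΛ : IsSimpleArrangement U Λ)
    {H : Set (Set X)} (hH : H ⊆ 𝒢) (hHne : H.Nonempty) (hne : (⋂₀ H).Nonempty)
    (hHG : ⋂₀ H ∉ 𝒢) {A : Set X} (hA : A ∈ factors 𝒢 (⋂₀ H)) :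
    {B ∈ H | A ⊆ B}.Nonempty ∧ ⋂₀ {B ∈ H | A ⊆ B} = A := by
  have hHΛ := hH.trans hG.1
  have hAΛ := hG.1 (mem_of_mem_factors hA)
  obtain ⟨hmem, -⟩ := hΛ.sInter hHΛ hHne hne
  obtain ⟨y, hyH, hy⟩ := nonempty_inter_closedPoints hne (hΛ.mem _ hmem).isLocallyClosed
  have hyA : y ∈ A := subset_of_mem_factors hA hyH
  have hconormal := hG.conormalSpace_eq_iSup hΛ hH hHne hHG hyH hy hA
  have hKne : {B ∈ H | A ⊆ B}.Nonempty := by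
    by_contra! hK
    obtain ⟨B, hB⟩ := hHne
    have hBA : B ⊆ A := by
      rw [hΛ.subset_iff_conormalSpace_le (hHΛ hB) hAΛ ⟨hyH B hB, hyA⟩ hy, hconormal, hK]
      simp
    exact hK.subset ⟨hB, hA.2 ⟨hH hB, Set.sInter_subset_of_mem hB⟩ hBA⟩
  have hyK : y ∈ ⋂₀ {B ∈ H | A ⊆ B} := fun B hB => hyH B hB.1
  obtain ⟨hKmem, hKconormal⟩ := hΛ.sInter ((Set.sep_subset _ _).trans hHΛ) hKne ⟨y, hyK⟩
  refine ⟨hKne, Set.Subset.antisymm ?_ (Set.subset_sInter fun B hB => hB.2)⟩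
  rw [hΛ.subset_iff_conormalSpace_le hKmem hAΛ ⟨hyK, hyA⟩ hy, hKconormal y hyK hy, hconormal]

theorem IsSimpleBuilding.factors_sInter_eq [IsLocallyNoetherian X] [JacobsonSpace X]
    (hG : IsSimpleBuilding 𝒢 Λ) (hΛ : IsSimpleArrangement U Λ) {H : Set (Set X)} (hH : H ⊆ 𝒢)
    (hnt : H.Nontrivial) (hne : (⋂₀ H).Nonempty)
    (hmem : ∀ K ⊆ H, K.Nontrivial → ⋂₀ K ∉ 𝒢) : factors 𝒢 (⋂₀ H) = H := by
  have hfactor : ∀ A ∈ factors 𝒢 (⋂₀ H), {B ∈ H | A ⊆ B} = {A} := by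
    intro A hA
    obtain ⟨hKne, hK⟩ := hG.nonempty_and_sInter_eq_of_mem_factors hΛ hH hnt.nonempty hne
      (hmem H subset_rfl hnt) hA
    obtain ⟨B, hB⟩ | hKnt := hKne.exists_eq_singleton_or_nontrivial
    · rw [hB, Set.sInter_singleton] at hK
      rw [hB, hK]
    · exact absurd (Set.mem_of_eq_of_mem hK (mem_of_mem_factors hA))
        (hmem _ (Set.sep_subset _ _) hKnt)
  refine Set.Subset.antisymm (fun A hA => ((hfactor A hA).symm.subset rfl).1) fun B hB => ?_
  obtain ⟨A, hA, hAB⟩ := exists_mem_factors_subset (hΛ.finite.subset hG.1) (hH hB)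
    (Set.sInter_subset_of_mem hB)
  rwa [(hfactor A hA).subset ⟨hB, hAB⟩]

end SimpleArrangement

section Restriction

variable {X : Scheme.{u}} {U : X.Opens} {P Q Λ 𝒢 : Set (Set X)} {A B D : Set X}

lemma IsArrMember.isClosed (hA : IsArrMember ⊤ A) : IsClosed A := by
  obtain ⟨C, hC, rfl⟩ := hA.closed_in
  simpa using hC

lemma inter_mem_restr (hA : A ∈ P) (hAU : (A ∩ U).Nonempty) : A ∩ U ∈ restr P U :=
  ⟨A, hA, hAU, rfl⟩

lemma restr_mono (h : P ⊆ Q) (U : X.Opens) : restr P U ⊆ restr Q U := by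
  rintro _ ⟨A, hA, hAU, rfl⟩
  exact inter_mem_restr (h hA) hAU

lemma restr_eq_image (hP : ∀ A ∈ P, (A ∩ U).Nonempty) : restr P U = (· ∩ (U : Set X)) '' P := by
  ext M
  constructor
  · rintro ⟨A, hA, -, rfl⟩
    exact ⟨A, hA, rfl⟩
  · rintro ⟨A, hA, rfl⟩
    exact inter_mem_restr hA (hP A hA)

lemma sInter_restr (hPne : P.Nonempty) (hP : ∀ A ∈ P, (A ∩ U).Nonempty) :
    ⋂₀ restr P U = ⋂₀ P ∩ U := by
  rw [restr_eq_image hP, Set.sInter_image, Set.biInter_inter hPne, Set.sInter_eq_biInter]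

variable [IsLocallyNoetherian X] [JacobsonSpace X]

lemma IsArrMember.inter_subset_inter_iff (hA : IsArrMember ⊤ A) (hB : IsArrMember ⊤ B)
    (hAU : (A ∩ U).Nonempty) : A ∩ U ⊆ B ∩ U ↔ A ⊆ B :=
  ⟨fun h => subset_of_inter_subset hA.isIrreducible.isPreirreducible hB.isClosed U.isOpen hAU
    (h.trans Set.inter_subset_left), fun h => Set.inter_subset_inter_left _ h⟩

lemma IsArrMember.inter_eq_inter_iff (hA : IsArrMember ⊤ A) (hB : IsArrMember ⊤ B)
    (hAU : (A ∩ U).Nonempty) : A ∩ U = B ∩ U ↔ A = B := by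
  refine ⟨fun h => ?_, fun h => h ▸ rfl⟩
  exact ((hA.inter_subset_inter_iff hB hAU).1 h.subset).antisymm
    ((hB.inter_subset_inter_iff hA (h ▸ hAU)).1 h.symm.subset)

lemma inter_mem_restr_iff (hA : IsArrMember ⊤ A) (hP : ∀ B ∈ P, IsArrMember ⊤ B)
    (hAU : (A ∩ U).Nonempty) : A ∩ U ∈ restr P U ↔ A ∈ P := by
  refine ⟨?_, fun h => inter_mem_restr h hAU⟩
  rintro ⟨B, hB, -, hAB⟩
  rwa [(hA.inter_eq_inter_iff (hP B hB) hAU).1 hAB]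

lemma eq_of_restr_eq (hP : ∀ A ∈ P, IsArrMember ⊤ A) (hPU : ∀ A ∈ P, (A ∩ U).Nonempty)
    (hQ : ∀ A ∈ Q, IsArrMember ⊤ A) (hQU : ∀ A ∈ Q, (A ∩ U).Nonempty)
    (h : restr P U = restr Q U) : P = Q := by
  ext A
  refine ⟨fun hA => ?_, fun hA => ?_⟩
  · exact (inter_mem_restr_iff (hP A hA) hQ (hPU A hA)).1 (h ▸ inter_mem_restr hA (hPU A hA))
  · exact (inter_mem_restr_iff (hQ A hA) hP (hQU A hA)).1 (h ▸ inter_mem_restr hA (hQU A hA))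

lemma injOn_inter (hP : ∀ A ∈ P, IsArrMember ⊤ A) (hPU : ∀ A ∈ P, (A ∩ U).Nonempty) :
    Set.InjOn (· ∩ (U : Set X)) P := fun A hA B hB h =>
  ((hP A hA).inter_eq_inter_iff (hP B hB) (hPU A hA)).1 h

lemma nontrivial_restr_iff (hP : ∀ A ∈ P, IsArrMember ⊤ A) (hPU : ∀ A ∈ P, (A ∩ U).Nonempty) :
    (restr P U).Nontrivial ↔ P.Nontrivial := by
  rw [restr_eq_image hPU, (injOn_inter hP hPU).image_nontrivial_iff]

lemma isAntichain_restr_iff (hP : ∀ A ∈ P, IsArrMember ⊤ A) (hPU : ∀ A ∈ P, (A ∩ U).Nonempty) :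
    IsAntichain (· ⊆ ·) (restr P U) ↔ IsAntichain (· ⊆ ·) P := by
  rw [restr_eq_image hPU, IsAntichain, (injOn_inter hP hPU).pairwise_image]
  refine forall₅_congr fun A hA B hB _ => not_congr ?_
  exact (hP A hA).inter_subset_inter_iff (hP B hB) (hPU A hA)

lemma factors_restr (h𝒢 : ∀ G ∈ 𝒢, IsArrMember ⊤ G) (hD : IsArrMember ⊤ D)
    (hDU : (D ∩ U).Nonempty) : factors (restr 𝒢 U) (D ∩ U) = restr (factors 𝒢 D) U := by
  have hmono : ∀ {G : Set X}, D ⊆ G → D ∩ U ⊆ G ∩ U := fun h => Set.inter_subset_inter_left _ h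
  ext M
  constructor
  · rintro ⟨⟨⟨G, hG, hGU, rfl⟩, hDG⟩, hmin⟩
    refine ⟨G, ⟨⟨hG, (hD.inter_subset_inter_iff (h𝒢 G hG) hDU).1 hDG⟩, ?_⟩, hGU, rfl⟩
    rintro G' ⟨hG', hDG'⟩ hle
    exact ((h𝒢 G hG).inter_subset_inter_iff (h𝒢 G' hG') hGU).1
      (hmin ⟨inter_mem_restr hG' (hDU.mono (hmono hDG')), hmono hDG'⟩
        (Set.inter_subset_inter_left _ hle))
  · rintro ⟨G, ⟨⟨hG, hDG⟩, hmin⟩, hGU, rfl⟩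
    refine ⟨⟨inter_mem_restr hG hGU, hmono hDG⟩, ?_⟩
    rintro _ ⟨⟨G', hG', hG'U, rfl⟩, hDG'⟩ hle
    exact Set.inter_subset_inter_left _
      (hmin ⟨hG', (hD.inter_subset_inter_iff (h𝒢 G' hG') hDU).1 hDG'⟩
        (((h𝒢 G' hG').inter_subset_inter_iff (h𝒢 G hG) hG'U).1 hle))

end Restriction

section Arrangement

variable {X : Scheme.{u}} {U : X.Opens} {Λ 𝒢 H S : Set (Set X)} {𝒰 : Set X.Opens}

lemma IsBuildingCover.exists_mem (h𝒰 : IsBuildingCover 𝒢 Λ 𝒰) (x : X) : ∃ U ∈ 𝒰, x ∈ U := by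
  have hx : x ∈ sSup 𝒰 := h𝒰.1 ▸ Opens.mem_top x
  simpa only [Opens.mem_sSup] using hx

lemma isConnected_of_components_subsingleton {Z : Set X} (hZ : Z.Nonempty)
    (h : (components Z).Subsingleton) : _root_.IsConnected Z := by
  obtain ⟨x, hx⟩ := hZ
  have hZx : Z = connectedComponentIn Z x := by
    refine Set.Subset.antisymm (fun z hz => ?_) (connectedComponentIn_subset _ _)
    rw [h ⟨x, hx, rfl⟩ ⟨z, hz, rfl⟩]
    exact mem_connectedComponentIn hz
  rw [hZx]
  exact isConnected_connectedComponentIn_iff.2 hx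

lemma IsWellConnected.isConnected_sInter (hwc : IsWellConnected 𝒢) (hH : H ⊆ 𝒢)
    (hc : _root_.IsConnected (⋂₀ H ∩ U)) (hmem : ⋂₀ H ∩ U ∉ restr 𝒢 U) :
    _root_.IsConnected (⋂₀ H) := by
  obtain ⟨x, hx⟩ := hc.nonempty
  refine isConnected_of_components_subsingleton ⟨x, hx.1⟩ ?_
  rw [← Set.not_nontrivial_iff]
  intro hnt
  have hC : connectedComponentIn (⋂₀ H) x ∈ 𝒢 := hwc H hH hnt ⟨x, hx.1, rfl⟩
  have hCU : connectedComponentIn (⋂₀ H) x ∩ U = ⋂₀ H ∩ U :=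
    (Set.inter_subset_inter_left _ (connectedComponentIn_subset _ _)).antisymm <|
      Set.subset_inter (hc.isPreconnected.subset_connectedComponentIn hx Set.inter_subset_left)
        Set.inter_subset_right
  exact hmem (hCU ▸ inter_mem_restr hC (hCU ▸ hc.nonempty))

lemma nonempty_sInter_of_isAntichain {α : Type*} [Nonempty α] {S : Set (Set α)} (hS : S.Finite)
    (hne : ∀ A ∈ S, A.Nonempty)
    (h : ∀ H ⊆ S, IsAntichain (· ⊆ ·) H → H.Nontrivial → (⋂₀ H).Nonempty) :
    (⋂₀ S).Nonempty := by
  let M : Set (Set α) := {A | Minimal (· ∈ S) A}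
  have hMS : M ⊆ S := fun A hA => hA.1
  suffices hM : (⋂₀ M).Nonempty by
    obtain ⟨p, hp⟩ := hM
    refine ⟨p, fun A hA => ?_⟩
    obtain ⟨B, hBA, hB⟩ := hS.exists_le_minimal hA
    exact hBA (hp B hB)
  obtain hM | hM := M.subsingleton_or_nontrivial
  · obtain hM | ⟨A, hM⟩ := hM.eq_empty_or_singleton
    · simp [hM]
    · rw [hM, Set.sInter_singleton]
      exact hne A (hMS (hM ▸ rfl))
  · exact h M hMS (setOfPred_minimal_antichain _) hM

variable [IsLocallyNoetherian X] [JacobsonSpace X]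

lemma IsBuildingCover.sInter_mem (h𝒰 : IsBuildingCover 𝒢 Λ 𝒰) (hΛ : ∀ L ∈ Λ, IsArrMember ⊤ L)
    (hH : H ⊆ Λ) (hHne : H.Nonempty) (hc : _root_.IsConnected (⋂₀ H)) : ⋂₀ H ∈ Λ := by
  have hlocal : ∀ x ∈ ⋂₀ H, ∃ U ∈ 𝒰, x ∈ U ∧ ⋂₀ H ∩ U ∈ restr Λ U := by
    intro x hx
    obtain ⟨U, hU, hxU⟩ := h𝒰.exists_mem x
    have hHU : ⋂₀ restr H U = ⋂₀ H ∩ U := sInter_restr hHne fun A hA => ⟨x, hx A hA, hxU⟩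
    obtain ⟨A, hA⟩ := hHne
    refine ⟨U, hU, hxU, hHU ▸ ((h𝒰.2 U hU).1.sInter (restr_mono hH U)
      ⟨_, inter_mem_restr hA ⟨x, hx A hA, hxU⟩⟩ (hHU ▸ ⟨x, hx, hxU⟩)).1⟩
  have hirr : IsPreirreducible (⋂₀ H) := by
    refine isPreirreducible_of_isPreconnected_of_locally hc.isPreconnected fun x hx => ?_
    obtain ⟨U, hU, hxU, hmem⟩ := hlocal x hx
    exact ⟨U, U.isOpen, hxU, ((h𝒰.2 U hU).1.mem _ hmem).isIrreducible.isPreirreducible⟩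
  have hclosed : IsClosed (⋂₀ H) := isClosed_sInter fun A hA => (hΛ A (hH hA)).isClosed
  obtain ⟨x, hx⟩ := hc.nonempty
  obtain ⟨U, -, -, L, hL, hLU, heq⟩ := hlocal x hx
  have hsub : ⋂₀ H ⊆ L := subset_of_inter_subset hirr (hΛ L hL).isClosed U.isOpen (heq ▸ hLU)
    (heq.subset.trans Set.inter_subset_left)
  have hsup : L ⊆ ⋂₀ H := subset_of_inter_subset (hΛ L hL).isIrreducible.isPreirreducible hclosed
    U.isOpen hLU (heq.symm.subset.trans Set.inter_subset_left)
  rwa [hsub.antisymm hsup]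

lemma IsBuildingCover.iSupIndep_conormalSpace_factors (h𝒰 : IsBuildingCover 𝒢 Λ 𝒰)
    (hΛ : ∀ L ∈ Λ, IsArrMember ⊤ L) (h𝒢 : 𝒢 ⊆ Λ) {D : Set X} (hD : D ∈ Λ \ 𝒢) {y : X}
    (hyD : y ∈ D) (hy : IsClosed ({y} : Set X)) :
    iSupIndep fun A : factors 𝒢 D => conormalSpace (A : Set X) y := by
  have h𝒢arr : ∀ G ∈ 𝒢, IsArrMember ⊤ G := fun G hG => hΛ G (h𝒢 hG)
  obtain ⟨U, hU, hyU⟩ := h𝒰.exists_mem y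
  have hDU : (D ∩ U).Nonempty := ⟨y, hyD, hyU⟩
  have hmem : D ∩ U ∈ restr Λ U \ restr 𝒢 U :=
    ⟨inter_mem_restr hD.1 hDU, fun h => hD.2 ((inter_mem_restr_iff (hΛ D hD.1) h𝒢arr hDU).1 h)⟩
  have hindep := ((h𝒰.2 U hU).2.2 _ hmem).1 y
    (fun A hA => subset_of_mem_factors hA ⟨hyD, hyU⟩) hy
  have hmeet : ∀ A ∈ factors 𝒢 D, (A ∩ U).Nonempty :=
    fun A hA => ⟨y, subset_of_mem_factors hA hyD, hyU⟩
  have hAU : ∀ A ∈ factors 𝒢 D, A ∩ U ∈ factors (restr 𝒢 U) (D ∩ U) := by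
    rw [factors_restr h𝒢arr (hΛ D hD.1) hDU]
    exact fun A hA => inter_mem_restr hA (hmeet A hA)
  have hinj : Set.InjOn (· ∩ (U : Set X)) (factors 𝒢 D) :=
    injOn_inter (fun A hA => h𝒢arr A (mem_of_mem_factors hA)) hmeet
  have hrestr := hindep.comp (f := fun A : factors 𝒢 D => ⟨A ∩ U, hAU A A.2⟩)
    fun A B hAB => Subtype.ext (hinj A.2 B.2 (congrArg Subtype.val hAB))
  simpa only [Function.comp_def, conormalSpace_inter_open _ U hyU] using hrestr

end Arrangement

section Nested

variable {X : Scheme.{u}} [IsLocallyNoetherian X] [JacobsonSpace X] {Λ 𝒢 H S : Set (Set X)}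
  {𝒰 : Set X.Opens} {W : X.Opens}

lemma factors_restr_sInter_eq (hH𝒢 : H ⊆ 𝒢) (h𝒢 : ∀ G ∈ 𝒢, IsArrMember ⊤ G)
    (hHW : ∀ A ∈ H, (A ∩ W).Nonempty) (hG : IsSimpleBuilding (restr 𝒢 W) (restr Λ W))
    (hS : IsSimpleNested (restr 𝒢 W) (restr Λ W) (restr S W)) (hHS : H ⊆ S)
    (hanti : IsAntichain (· ⊆ ·) H) (hnt : H.Nontrivial) :
    ⋂₀ H ∩ W ∈ restr Λ W \ restr 𝒢 W ∧ factors (restr 𝒢 W) (⋂₀ H ∩ W) = restr H W := by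
  have hHarr : ∀ A ∈ H, IsArrMember ⊤ A := fun A hA => h𝒢 A (hH𝒢 hA)
  obtain ⟨L, hL, hLH⟩ := hS.2 _ (restr_mono hHS W) ((isAntichain_restr_iff hHarr hHW).2 hanti)
    ((nontrivial_restr_iff hHarr hHW).2 hnt)
  have hHL : ⋂₀ H ∩ W = L := by
    rw [← sInter_restr hnt.nonempty hHW, ← hLH]
    exact (hG.2 L hL).2
  exact hHL ▸ ⟨hL, hLH⟩

theorem IsNested.isConnected_isTransversal_sInter (hS : IsNested 𝒢 Λ S)
    (hΛ : ∀ L ∈ Λ, IsArrMember ⊤ L) (h𝒢 : 𝒢 ⊆ Λ) (hwc : IsWellConnected 𝒢) (hHS : H ⊆ S)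
    (hanti : IsAntichain (· ⊆ ·) H) (hnt : H.Nontrivial) :
    (⋂₀ H).Nonempty ∧ _root_.IsConnected (⋂₀ H) ∧ IsTransversal H ∧ ⋂₀ H ∉ 𝒢 := by
  obtain ⟨hS𝒢, 𝒰, h𝒰, W, hW, hSW, hnested⟩ := hS
  obtain ⟨hsimple, hbuilding⟩ := h𝒰.2 W hW
  have hH𝒢 : H ⊆ 𝒢 := hHS.trans hS𝒢
  have h𝒢arr : ∀ G ∈ 𝒢, IsArrMember ⊤ G := fun G hG => hΛ G (h𝒢 hG)
  have hHW : ∀ A ∈ H, (A ∩ W).Nonempty := fun A hA => hSW A (hHS hA)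
  obtain ⟨⟨hWΛ, hW𝒢⟩, hfactorsW⟩ :=
    factors_restr_sInter_eq hH𝒢 h𝒢arr hHW hbuilding hnested hHS hanti hnt
  have hconnW : _root_.IsConnected (⋂₀ H ∩ W) := (hsimple.mem _ hWΛ).connected
  have hconn : _root_.IsConnected (⋂₀ H) := hwc.isConnected_sInter hH𝒢 hconnW hW𝒢
  have hmem : ⋂₀ H ∈ Λ := h𝒰.sInter_mem hΛ (hH𝒢.trans h𝒢) hnt.nonempty hconn
  have hnotMem : ⋂₀ H ∉ 𝒢 := fun h => hW𝒢 (inter_mem_restr h hconnW.nonempty)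
  have hfactors : factors 𝒢 (⋂₀ H) = H := by
    refine eq_of_restr_eq (U := W) (fun A hA => h𝒢arr A (mem_of_mem_factors hA))
      (fun A hA => hconnW.nonempty.mono (Set.inter_subset_inter_left _ (subset_of_mem_factors hA)))
      (fun A hA => h𝒢arr A (hH𝒢 hA)) hHW ?_
    rw [← factors_restr h𝒢arr (hΛ _ hmem) hconnW.nonempty, hfactorsW]
  refine ⟨hconn.nonempty, hconn, fun y hyH hy => ?_, hnotMem⟩
  have hindep := h𝒰.iSupIndep_conormalSpace_factors hΛ h𝒢 ⟨hmem, hnotMem⟩ hyH hy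
  rwa [hfactors] at hindep

lemma IsBuildingCover.sInter_notMem_restr (h𝒰 : IsBuildingCover 𝒢 Λ 𝒰)
    (hΛ : ∀ L ∈ Λ, IsArrMember ⊤ L) (h𝒢 : 𝒢 ⊆ Λ) (hS : S ⊆ 𝒢)
    (h : ∀ K ⊆ S, IsAntichain (· ⊆ ·) K → K.Nontrivial →
      _root_.IsConnected (⋂₀ K) ∧ ⋂₀ K ∉ 𝒢) {p : X} (hpS : p ∈ ⋂₀ S) (hpW : p ∈ W)
    (hH : H ⊆ restr S W) (hanti : IsAntichain (· ⊆ ·) H) (hnt : H.Nontrivial) :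
    ⋂₀ H ∉ restr 𝒢 W := by
  have hSW : ∀ A ∈ S, (A ∩ W).Nonempty := fun A hA => ⟨p, hpS A hA, hpW⟩
  obtain ⟨K, hKS, rfl⟩ : ∃ K ⊆ S, restr K W = H := by
    rw [restr_eq_image hSW] at hH
    obtain ⟨K, hKS, rfl⟩ := Set.subset_image_iff.1 hH
    exact ⟨K, hKS, restr_eq_image fun A hA => hSW A (hKS hA)⟩
  have hKΛ : K ⊆ Λ := (hKS.trans hS).trans h𝒢
  have hKarr : ∀ A ∈ K, IsArrMember ⊤ A := fun A hA => hΛ A (hKΛ hA)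
  have hKW : ∀ A ∈ K, (A ∩ W).Nonempty := fun A hA => hSW A (hKS hA)
  rw [isAntichain_restr_iff hKarr hKW] at hanti
  rw [nontrivial_restr_iff hKarr hKW] at hnt
  obtain ⟨hconn, hnotMem⟩ := h K hKS hanti hnt
  have hmem := h𝒰.sInter_mem hΛ hKΛ hnt.nonempty hconn
  have hpK : (⋂₀ K ∩ W).Nonempty := ⟨p, Set.sInter_subset_sInter hKS hpS, hpW⟩
  rwa [sInter_restr hnt.nonempty hKW,
    inter_mem_restr_iff (hΛ _ hmem) (fun G hG => hΛ G (h𝒢 hG)) hpK]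

theorem isNested_of_isConnected_sInter [Nonempty X] (hΛfin : Λ.Finite)
    (hΛ : ∀ L ∈ Λ, IsArrMember ⊤ L) (hG : IsBuilding 𝒢 Λ) (hS : S ⊆ 𝒢)
    (h : ∀ H ⊆ S, IsAntichain (· ⊆ ·) H → H.Nontrivial →
      _root_.IsConnected (⋂₀ H) ∧ ⋂₀ H ∉ 𝒢) : IsNested 𝒢 Λ S := by
  obtain ⟨h𝒢, 𝒰, h𝒰⟩ := hG
  have hSΛ : S ⊆ Λ := hS.trans h𝒢
  obtain ⟨p, hpS⟩ := nonempty_sInter_of_isAntichain (hΛfin.subset hSΛ)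
    (fun A hA => (hΛ A (hSΛ hA)).connected.nonempty)
    fun H hHS hanti hnt => (h H hHS hanti hnt).1.nonempty
  obtain ⟨W, hW, hpW⟩ := h𝒰.exists_mem p
  obtain ⟨hsimple, hbuilding⟩ := h𝒰.2 W hW
  refine ⟨hS, 𝒰, h𝒰, W, hW, fun A hA => ⟨p, hpS A hA, hpW⟩, restr_mono hS W,
    fun H hHS hanti hnt => ?_⟩
  have hH𝒢 : H ⊆ restr 𝒢 W := hHS.trans (restr_mono hS W)
  have hne : (⋂₀ H).Nonempty := by
    refine ⟨p, fun M hM => ?_⟩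
    obtain ⟨A, hA, -, rfl⟩ := hHS hM
    exact ⟨hpS A hA, hpW⟩
  have hnotMem : ∀ K ⊆ H, K.Nontrivial → ⋂₀ K ∉ restr 𝒢 W := fun K hKH hK =>
    h𝒰.sInter_notMem_restr hΛ h𝒢 hS h hpS hpW (hKH.trans hHS) (hanti.subset hKH) hK
  exact ⟨⋂₀ H, ⟨(hsimple.sInter (hH𝒢.trans hbuilding.1) hnt.nonempty hne).1,
    hnotMem H subset_rfl hnt⟩, hbuilding.factors_sInter_eq hsimple hH𝒢 hnt hne hnotMem⟩

end Nested

theorem mainTheorem2_general {X : Scheme.{u}} [Nonempty X] [IsLocallyNoetherian X]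
    [JacobsonSpace X] {Λ 𝒢 : Set (Set X)} (hΛ : IsArrangement ⊤ Λ) (hG : IsBuilding 𝒢 Λ)
    (hwc : IsWellConnected 𝒢) {S : Set (Set X)} (hS : S ⊆ 𝒢) :
    IsNested 𝒢 Λ S ↔
      ∀ H ⊆ S, IsAntichain (· ⊆ ·) H → H.Nontrivial →
        (⋂₀ H).Nonempty ∧ _root_.IsConnected (⋂₀ H) ∧ IsTransversal H ∧ ⋂₀ H ∉ 𝒢 := by
  constructor
  · exact fun hnested H => hnested.isConnected_isTransversal_sInter hΛ.mem hG.1 hwc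
  · intro hcriterion
    refine isNested_of_isConnected_sInter hΛ.finite hΛ.mem hG hS fun H hHS hanti hnt => ?_
    obtain ⟨-, hconn, -, hnotMem⟩ := hcriterion H hHS hanti hnt
    exact ⟨hconn, hnotMem⟩

end WonderfulArr

theorem mainTheorem2 {k : Type u} [Field k] [IsAlgClosed k] (X : Scheme.{u})
    (f : X ⟶ Spec (CommRingCat.of k)) [IsIntegral X] [IsSeparated f] [LocallyOfFiniteType f]
    [QuasiCompact f]
    (hX : ∀ y : X, IsClosed ({y} : Set X) → IsRegularLocalRing (X.presheaf.stalk y))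
    (Λ 𝒢 : Set (Set X)) (hΛ : WonderfulArr.IsArrangement ⊤ Λ) (hG : WonderfulArr.IsBuilding 𝒢 Λ)
    (hwc : WonderfulArr.IsWellConnected 𝒢) (S : Set (Set X)) (hS : S ⊆ 𝒢) :
    WonderfulArr.IsNested 𝒢 Λ S ↔
      ∀ H ⊆ S, IsAntichain (· ⊆ ·) H → H.Nontrivial →
        (⋂₀ H).Nonempty ∧ _root_.IsConnected (⋂₀ H) ∧ WonderfulArr.IsTransversal H ∧ ⋂₀ H ∉ 𝒢 := by
  have : IsLocallyNoetherian X := LocallyOfFiniteType.isLocallyNoetherian f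
  have : JacobsonSpace X := LocallyOfFiniteType.jacobsonSpace f
  exact WonderfulArr.mainTheorem2_general hΛ hG hwc hS
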